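/- All graphs are finite and simple. For a graph $G$ with vertex set $V(G)$, a set $S\subseteq V(G)$ is dominating if every vertex of $G$ not in $S$ is adjacent to at least one vertex of $S$. Let $d(G,i)$ be the number of dominating sets of $G$ of cardinality $i$, and let $D(G,x)=\sum_{i=1}^{|V(G)|} d(G,i)\,x^i$ be the domination polynomial of $G$. Let $C_n$ be the cycle of order $n$, with the convention $C_1=K_1$ and $C_2=K_2$. Theorem. For every positive integer $n$, the cycle $C_n$ is $\mathcal{D}$-unique: for every graph $G$, one has $D(G,x)=D(C_n,x)$ if and only if $G$ is isomorphic to $C_n$. -/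

import Mathlib

/-- The closed neighborhood `N[v] = {u | uv ∈ E} ∪ {v}` of a vertex `v`. -/
def SimpleGraph.closedNeighborSet {V : Type*} (G : SimpleGraph V) (v : V) : Set V :=
  G.neighborSet v ∪ {v}

/-- A set `S` of vertices is dominating if `N[S] = ⋃ v ∈ S, N[v]` is the whole vertex set. -/
def SimpleGraph.IsDominatingSet {V : Type*} (G : SimpleGraph V) (S : Set V) : Prop :=
  (⋃ v ∈ S, G.closedNeighborSet v) = Set.univ

/-- Equivalently, every vertex outside `S` is adjacent to a vertex of `S`. -/
theorem SimpleGraph.isDominatingSet_iff {V : Type*} (G : SimpleGraph V) (S : Set V) :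
    G.IsDominatingSet S ↔ ∀ u, u ∉ S → ∃ v ∈ S, G.Adj v u := by
  simp only [IsDominatingSet, closedNeighborSet, Set.eq_univ_iff_forall, Set.mem_iUnion,
    Set.mem_union, mem_neighborSet, Set.mem_singleton_iff, exists_prop]
  refine forall_congr' fun u => ⟨?_, fun h => ?_⟩
  · rintro ⟨v, hv, h | rfl⟩ hu
    · exact ⟨v, hv, h⟩
    · exact absurd hv hu
  · by_cases hu : u ∈ S
    · exact ⟨u, hu, Or.inr rfl⟩
    · obtain ⟨v, hv, hvu⟩ := h hu
      exact ⟨v, hv, Or.inl hvu⟩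

open Classical in
/-- `d(G, i)`: the number of dominating sets of `G` of cardinality `i`. -/
noncomputable def SimpleGraph.numDominatingSets {V : Type*} [Fintype V] (G : SimpleGraph V)
    (i : ℕ) : ℕ :=
  {S ∈ Finset.powersetCard i (Finset.univ : Finset V) | G.IsDominatingSet (S : Set V)}.card

/-- The domination polynomial `D(G, x) = ∑_{i = 1}^{|V(G)|} d(G, i) x ^ i`. -/
noncomputable def SimpleGraph.dominationPolynomial {V : Type*} [Fintype V]
    (G : SimpleGraph V) : Polynomial ℤ :=
  ∑ i ∈ Finset.Icc 1 (Fintype.card V),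
    Polynomial.C (G.numDominatingSets i : ℤ) * Polynomial.X ^ i

/-- Two finite graphs are `D`-equivalent if they have the same domination polynomial. -/
def SimpleGraph.DEquivalent {V W : Type*} [Fintype V] [Fintype W]
    (G : SimpleGraph V) (H : SimpleGraph W) : Prop :=
  G.dominationPolynomial = H.dominationPolynomial

universe u v

/-- A finite graph `G` is `D`-unique if its `D`-equivalence class consists, up to isomorphism,
of `G` alone (the graphs `H` of the class range over the finite graphs on types in `Type v`). -/
def SimpleGraph.IsDUnique {V : Type u} [Fintype V] (G : SimpleGraph V) : Prop :=
  ∀ (W : Type v) [Fintype W] (H : SimpleGraph W), H.DEquivalent G ↔ Nonempty (H ≃g G)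

/-! Let `H` have the same domination polynomial as the cycle `C_n`.

If `n ≤ 3` then `C_n` is complete, and completeness is visible in the number of dominating sets of
size one (`eq_top_iff_numDominatingSets_one`).

If `n ≥ 4`, count dominating sets by their complements: a set `T` is the complement of a dominating
set iff it contains no closed neighborhood. The count for `|T| = 2` shows that every closed
neighborhood of `H` has at least three elements, and the count for `|T| = 3` then shows that `H` has
exactly `n` distinct closed neighborhoods of size three. Hence `H` is regular of degree two
(`DEquivalent.ncard_neighborSet_eq_two`), and its components are cycles
(`Connected.nonempty_iso_cycleGraph`), of lengths `n_1, …, n_r` with sum `n`.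

It remains to exclude `r ≥ 2`. The sum of `y ^ |T|` over the admissible sets `T`, a reversal of the
domination polynomial, is multiplicative over components. For a cycle `C_k` it counts cyclic binary
words without three consecutive letters `true`, so by the transfer matrix it is the power sum
`λ₁ ^ k + λ₂ ^ k + λ₃ ^ k` of the roots of `t³ = t² + y t + y²`. The substitution
`y = u (1 + u + u²)` makes one root rational, namely `1 + u + u²`, and the other two divisible by
`u`; the power sum becomes `(1 + u + u²) ^ k + u ^ k * s_k(u)`, where `s_k(0) = ω ^ k + ω⁻¹ ^ k` for
a primitive cube root of unity `ω`, so `s_k(0) ≠ 0`. If `m` is the smallest of the `n_i` and occurs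
`j` times among them, then the product over the components is
`(1 + u + u²) ^ n + j * s_m(0) * u ^ m` modulo `u ^ (m + 1)`, whereas the power sum of index `n`
is `(1 + u + u²) ^ n` modulo `u ^ n`. These differ when `m < n`
(`subsingleton_of_prod_rootPowerSum_eq`). -/

/-! ### Power sums of the rationally parametrised cubic -/

/-- With `y = u (1 + u + u²)` the cubic `t³ = t² + y t + y²` has the root `1 + u + u²`, and its two
other roots are `u τ₁` and `u τ₂` where `τ₁`, `τ₂` are the roots of
`τ² + (1 + u) τ + (1 + u + u²)`. This is the power sum `τ₁ ^ n + τ₂ ^ n`, defined by its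
recurrence. -/
def minorPowerSum {R : Type*} [CommRing R] (u : R) : ℕ → R
  | 0 => 2
  | 1 => -(1 + u)
  | n + 2 => -(1 + u) * minorPowerSum u (n + 1) - (1 + u + u ^ 2) * minorPowerSum u n

/-- The `n`-th power sum of the three roots of `t³ = t² + y t + y²`, where
`y = u (1 + u + u²)`. -/
def rootPowerSum {R : Type*} [CommRing R] (u : R) (n : ℕ) : R :=
  (1 + u + u ^ 2) ^ n + u ^ n * minorPowerSum u n

theorem rootPowerSum_add_three {R : Type*} [CommRing R] (u : R) (n : ℕ) :
    rootPowerSum u (n + 3) = rootPowerSum u (n + 2) +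
      u * (1 + u + u ^ 2) * rootPowerSum u (n + 1) +
      (u * (1 + u + u ^ 2)) ^ 2 * rootPowerSum u n := by
  simp only [rootPowerSum, minorPowerSum]
  ring

theorem map_minorPowerSum {R S : Type*} [CommRing R] [CommRing S] (φ : R →+* S) (u : R) (n : ℕ) :
    φ (minorPowerSum u n) = minorPowerSum (φ u) n := by
  induction n using Nat.twoStepInduction with
  | zero => exact map_ofNat φ 2
  | one => simp [minorPowerSum]
  | more n h0 h1 => simp [minorPowerSum, h0, h1]

theorem minorPowerSum_zero_ne_zero (n : ℕ) : minorPowerSum (0 : ℤ) n ≠ 0 := by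
  -- The roots are the primitive cube roots of unity, so the values are `2, -1, -1, 2, …`.
  have key : ∀ n, (minorPowerSum (0 : ℤ) n = 2 ∧ minorPowerSum (0 : ℤ) (n + 1) = -1) ∨
      (minorPowerSum (0 : ℤ) n = -1 ∧ minorPowerSum (0 : ℤ) (n + 1) = -1) ∨
      (minorPowerSum (0 : ℤ) n = -1 ∧ minorPowerSum (0 : ℤ) (n + 1) = 2) := by
    intro n
    induction n with
    | zero => simp [minorPowerSum]
    | succ n ih =>
      have h : minorPowerSum (0 : ℤ) (n + 2) =
        -minorPowerSum (0 : ℤ) (n + 1) - minorPowerSum (0 : ℤ) n := by simp [minorPowerSum]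
      have h' : n + 1 + 1 = n + 2 := rfl
      rw [h', h]
      omega
  have := key n
  omega

open Polynomial in
/-- First order expansion of a product of power sums in `ℤ[X]`, all of whose indices are at
least `m`: modulo `X ^ (m + 1)` it differs from the power of `1 + X + X ^ 2` by a multiple of
`X ^ m` to which only the factors of index exactly `m` contribute. The case `m = 0` is excluded
in the second part because then the factors are not congruent to `1` modulo `X`. -/
theorem exists_prod_rootPowerSum_eq {ι : Type*} (s : Finset ι) (k : ι → ℕ) (m : ℕ)
    (hm : ∀ i ∈ s, m ≤ k i) :
    ∃ t : ℤ[X], ∏ i ∈ s, rootPowerSum (X : ℤ[X]) (k i) =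
        (1 + X + X ^ 2) ^ (∑ i ∈ s, k i) + X ^ m * t ∧
      (0 < m → t.eval 0 = (s.filter (k · = m)).card * minorPowerSum (0 : ℤ) m) := by
  classical
  induction s using Finset.induction_on with
  | empty => exact ⟨0, by simp⟩
  | insert a s ha ih =>
    obtain ⟨t, ht, ht0⟩ := ih fun i hi => hm i (Finset.mem_insert_of_mem hi)
    obtain ⟨d, hd⟩ := Nat.exists_eq_add_of_le (hm a (Finset.mem_insert_self a s))
    refine ⟨(1 + X + X ^ 2) ^ (k a) * t + X ^ d * minorPowerSum X (k a) *
      ((1 + X + X ^ 2) ^ (∑ i ∈ s, k i) + X ^ m * t), ?_, fun hm0 => ?_⟩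
    · rw [Finset.prod_insert ha, ht, Finset.sum_insert ha, rootPowerSum]
      have : (X : ℤ[X]) ^ (k a) = X ^ m * X ^ d := by rw [hd, pow_add]
      rw [this]
      ring
    · have hev : (minorPowerSum (X : ℤ[X]) (k a)).eval 0 = minorPowerSum (0 : ℤ) (k a) := by
        have := map_minorPowerSum (evalRingHom (0 : ℤ)) X (k a)
        simpa using this
      rcases Nat.eq_zero_or_pos d with rfl | hd0
      · have hk : k a = m := by omega
        rw [hk] at hev
        simp [hev, ht0 hm0, Finset.filter_insert, hk, ha, hm0.ne']
        ring
      · have hk : k a ≠ m := by omega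
        simp [ht0 hm0, Finset.filter_insert, hk, hd0.ne', hm0.ne']

open Polynomial in
/-- A product of at least two power sums of positive index is not a power sum. -/
theorem subsingleton_of_prod_rootPowerSum_eq {ι : Type*} [Fintype ι] (k : ι → ℕ)
    (hk : ∀ i, 0 < k i)
    (h : ∏ i, rootPowerSum (X : ℤ[X]) (k i) = rootPowerSum X (∑ i, k i)) : Subsingleton ι := by
  classical
  by_contra hns
  rw [not_subsingleton_iff_nontrivial] at hns
  obtain ⟨a, ha⟩ := Finite.exists_min k
  obtain ⟨b, hb⟩ := exists_ne a
  obtain ⟨t, ht, ht0⟩ := exists_prod_rootPowerSum_eq Finset.univ k (k a) fun i _ => ha i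
  have hlt : k a < ∑ i, k i := by
    have h2 : ∑ i ∈ ({a, b} : Finset ι), k i ≤ ∑ i, k i :=
      Finset.sum_le_sum_of_subset (Finset.subset_univ _)
    rw [Finset.sum_pair hb.symm] at h2
    have := hk b
    omega
  obtain ⟨d, hd⟩ := Nat.exists_eq_add_of_lt hlt
  -- Cancelling `X ^ (k a)` leaves `t` equal to a multiple of `X`.
  have ht' : t = X ^ (d + 1) * minorPowerSum X (∑ i, k i) := by
    rw [ht, rootPowerSum] at h
    have h3 : (X : ℤ[X]) ^ (k a) * t =
        X ^ (k a) * (X ^ (d + 1) * minorPowerSum X (∑ i, k i)) := by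
      rw [← mul_assoc, ← pow_add, ← add_assoc, ← hd]
      exact add_left_cancel h
    exact mul_left_cancel₀ (pow_ne_zero _ X_ne_zero) h3
  have h0 := ht0 (hk a)
  rw [ht'] at h0
  have hcard : ((Finset.univ.filter (k · = k a)).card : ℤ) ≠ 0 := by
    rw [Nat.cast_ne_zero, ← Nat.pos_iff_ne_zero]
    exact Finset.card_pos.mpr ⟨a, by simp⟩
  exact mul_ne_zero hcard (minorPowerSum_zero_ne_zero (k a)) (by rw [← h0]; simp)

/-! ### Cyclic binary words without three consecutive letters `true` -/

/-- The weight of a letter `b` with neighbours `a` and `c` in a binary word: the letter `true` has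
weight `y`, and the factor `true true true` is forbidden. -/
def letterWeight {R : Type*} [CommRing R] (y : R) (a b c : Bool) : R :=
  (if b then y else 1) * (if a && b && c then 0 else 1)

/-- The weighted sum over all words with `n` letters which follow the letters `a b`, where each word
is closed off by the value of `φ` at its last two letters. -/
def wordSum {R : Type*} [CommRing R] (y : R) (φ : Bool → Bool → R) : ℕ → Bool → Bool → R
  | 0, a, b => φ a b
  | n + 1, a, b => ∑ c, letterWeight y a b c * wordSum y φ n b c

theorem wordSum_eq_sum {R : Type*} [CommRing R] (y : R) (φ : Bool → Bool → R) (n : ℕ)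
    (a b : Bool) :
    wordSum y φ n a b = ∑ f : Fin n → Bool,
      (∏ i : Fin n, letterWeight y
        ((Fin.cons a (Fin.cons b f) : Fin (n + 2) → Bool) i.castSucc.castSucc)
        ((Fin.cons a (Fin.cons b f) : Fin (n + 2) → Bool) i.succ.castSucc)
        ((Fin.cons a (Fin.cons b f) : Fin (n + 2) → Bool) i.succ.succ)) *
      φ ((Fin.cons a (Fin.cons b f) : Fin (n + 2) → Bool) (Fin.last n).castSucc)
        ((Fin.cons a (Fin.cons b f) : Fin (n + 2) → Bool) (Fin.last (n + 1))) := by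
  induction n generalizing a b with
  | zero => simp [wordSum, ← Fin.succ_last]
  | succ n ih =>
    rw [wordSum, ← (Fin.consEquiv fun _ : Fin (n + 1) => Bool).sum_comp, Fintype.sum_prod_type]
    refine Finset.sum_congr rfl fun c _ => ?_
    rw [ih, Finset.mul_sum]
    refine Finset.sum_congr rfl fun f _ => ?_
    rw [Fin.prod_univ_succ, ← mul_assoc]
    simp [Fin.consEquiv, ← Fin.succ_last]
    rfl

/-- The Cayley–Hamilton relation of the transfer matrix on pairs of consecutive letters. -/
theorem wordSum_add_four {R : Type*} [CommRing R] (y : R) (φ : Bool → Bool → R) (n : ℕ)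
    (a b : Bool) :
    wordSum y φ (n + 4) a b = wordSum y φ (n + 3) a b + y * wordSum y φ (n + 2) a b +
      y ^ 2 * wordSum y φ (n + 1) a b := by
  cases a <;> cases b <;> simp [wordSum, letterWeight] <;> ring

/-- The weighted sum over the cyclic binary words of length `n + 2`. -/
def cyclicWordSum {R : Type*} [CommRing R] (y : R) (n : ℕ) : R :=
  ∑ a, ∑ b, wordSum y (fun c d => letterWeight y c d a * letterWeight y d a b) n a b

theorem cyclicWordSum_eq_rootPowerSum {R : Type*} [CommRing R] (u : R) (n : ℕ) :
    cyclicWordSum (u * (1 + u + u ^ 2)) (n + 1) = rootPowerSum u (n + 3) := by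
  have hrec : ∀ (y : R) (n : ℕ), cyclicWordSum y (n + 4) = cyclicWordSum y (n + 3) +
      y * cyclicWordSum y (n + 2) + y ^ 2 * cyclicWordSum y (n + 1) := by
    intro y n
    simp only [cyclicWordSum, wordSum_add_four, Finset.sum_add_distrib, Finset.mul_sum]
  induction n using Nat.strong_induction_on with
  | _ n ih =>
    match n with
    | 0 =>
      simp [cyclicWordSum, wordSum, letterWeight, rootPowerSum, minorPowerSum]
      ring
    | 1 =>
      simp [cyclicWordSum, wordSum, letterWeight, rootPowerSum, minorPowerSum]
      ring
    | 2 =>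
      simp [cyclicWordSum, wordSum, letterWeight, rootPowerSum, minorPowerSum]
      ring
    | n + 3 =>
      rw [hrec, ih (n + 2) (by omega), ih (n + 1) (by omega), ih n (by omega),
        rootPowerSum_add_three u (n + 3)]

theorem cyclicWordSum_eq_sum {R : Type*} [CommRing R] (y : R) (n : ℕ) :
    cyclicWordSum y n = ∑ f : Fin (n + 2) → Bool,
      ∏ i, letterWeight y (f i) (f (i + 1)) (f (i + 2)) := by
  rw [← (Fin.consEquiv fun _ : Fin (n + 2) => Bool).sum_comp, Fintype.sum_prod_type]
  refine Finset.sum_congr rfl fun a _ => ?_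
  rw [← (Fin.consEquiv fun _ : Fin (n + 1) => Bool).sum_comp, Fintype.sum_prod_type]
  refine Finset.sum_congr rfl fun b _ => ?_
  rw [wordSum_eq_sum]
  refine Finset.sum_congr rfl fun f _ => ?_
  simp only [Fin.consEquiv, Equiv.coe_fn_mk]
  rw [Fin.prod_univ_castSucc, Fin.prod_univ_castSucc, mul_assoc]
  have e1 : ∀ i : Fin n, i.castSucc.castSucc + 1 = i.succ.castSucc := by
    intro i
    simp
  have e2 : ∀ i : Fin n, i.castSucc.castSucc + 2 = i.succ.succ := by
    intro i
    rw [show (2 : Fin (n + 2)) = 1 + 1 by rfl, ← add_assoc, e1]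
    exact Fin.coeSucc_eq_succ
  have e3 : (Fin.last n).castSucc + 1 = Fin.last (n + 1) := by simp
  have e4 : (Fin.last n).castSucc + 2 = 0 := by
    rw [show (2 : Fin (n + 2)) = 1 + 1 by rfl, ← add_assoc, e3]; simp
  have e5 : Fin.last (n + 1) + 1 = 0 := by simp
  have e6 : Fin.last (n + 1) + 2 = Fin.succ 0 := by
    rw [show (2 : Fin (n + 2)) = 1 + 1 by rfl, ← add_assoc, e5]; simp
  simp only [e1, e2, e3, e4, e5, e6, Fin.cons_zero, Fin.cons_succ]

namespace SimpleGraph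

/-! ### The coefficients of the domination polynomial -/

open Classical in
/-- In `numDominatingSets` the dominating sets are elements of a `Finset (Set V)`, the image of
`powersetCard` under the coercion. Here they are counted as elements of type `Finset V`. -/
theorem numDominatingSets_eq_card_filter {V : Type*} [Fintype V] (G : SimpleGraph V) (i : ℕ) :
    G.numDominatingSets i =
      ((Finset.univ.powersetCard i).filter
        fun S : Finset V => G.IsDominatingSet (S : Set V)).card := by
  rw [numDominatingSets, ← Finset.card_image_of_injective _ Finset.coe_injective]
  congr 1
  ext S
  simp only [Finset.bind_def, Finset.pure_def, Finset.mem_filter, Finset.mem_sup, Finset.mem_image,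
    Finset.mem_singleton]
  constructor
  · rintro ⟨⟨T, hT, rfl⟩, h⟩
    exact ⟨T, ⟨hT, h⟩, rfl⟩
  · rintro ⟨T, ⟨hT, h⟩, rfl⟩
    exact ⟨⟨T, hT, rfl⟩, h⟩

theorem numDominatingSets_eq_zero {V : Type*} [Fintype V] (G : SimpleGraph V) {i : ℕ}
    (hi : Fintype.card V < i) : G.numDominatingSets i = 0 := by
  have h : Finset.powersetCard i (Finset.univ : Finset V) = ∅ := by
    rw [Finset.powersetCard_eq_empty, Finset.card_univ]
    exact hi
  simp [numDominatingSets_eq_card_filter, h]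

theorem numDominatingSets_card {V : Type*} [Fintype V] (G : SimpleGraph V) :
    G.numDominatingSets (Fintype.card V) = 1 := by
  classical
  rw [numDominatingSets_eq_card_filter, ← Finset.card_univ, Finset.powersetCard_self,
    Finset.filter_true_of_mem, Finset.card_singleton]
  simp [isDominatingSet_iff]

theorem numDominatingSets_zero {V : Type*} [Fintype V] [Nonempty V] (G : SimpleGraph V) :
    G.numDominatingSets 0 = 0 := by
  simp [numDominatingSets_eq_card_filter, isDominatingSet_iff]

theorem coeff_dominationPolynomial {V : Type*} [Fintype V] (G : SimpleGraph V) {i : ℕ}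
    (hi : 1 ≤ i) : G.dominationPolynomial.coeff i = G.numDominatingSets i := by
  simp only [dominationPolynomial, Polynomial.finsetSum_coeff, Polynomial.coeff_C_mul_X_pow]
  rw [Finset.sum_ite_eq]
  split_ifs with h
  · rfl
  · rw [G.numDominatingSets_eq_zero (by simp at h; omega), Nat.cast_zero]

theorem DEquivalent.numDominatingSets_eq {V W : Type*} [Fintype V] [Fintype W]
    {G : SimpleGraph V} {H : SimpleGraph W} (h : G.DEquivalent H) {i : ℕ} (hi : 1 ≤ i) :
    G.numDominatingSets i = H.numDominatingSets i := by
  have := congrArg (fun p => p.coeff i) h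
  simp only [coeff_dominationPolynomial _ hi] at this
  exact_mod_cast this

theorem DEquivalent.card_le {V W : Type*} [Fintype V] [Fintype W]
    {G : SimpleGraph V} {H : SimpleGraph W} (h : G.DEquivalent H) :
    Fintype.card V ≤ Fintype.card W := by
  rcases Nat.eq_zero_or_pos (Fintype.card V) with h0 | h0
  · omega
  by_contra hlt
  have := h.numDominatingSets_eq h0
  rw [numDominatingSets_card, numDominatingSets_eq_zero _ (by omega)] at this
  omega

theorem DEquivalent.card_eq {V W : Type*} [Fintype V] [Fintype W]
    {G : SimpleGraph V} {H : SimpleGraph W} (h : G.DEquivalent H) :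
    Fintype.card V = Fintype.card W :=
  le_antisymm h.card_le (DEquivalent.card_le (Eq.symm h))

theorem Iso.isDominatingSet_image_iff {V W : Type*} {G : SimpleGraph V} {H : SimpleGraph W}
    (e : G ≃g H) (S : Set V) : H.IsDominatingSet (e '' S) ↔ G.IsDominatingSet S := by
  rw [isDominatingSet_iff, isDominatingSet_iff, e.surjective.forall]
  simp [e.injective.mem_set_image, e.map_adj_iff]

theorem Iso.numDominatingSets_eq {V W : Type*} [Fintype V] [Fintype W] {G : SimpleGraph V}
    {H : SimpleGraph W} (e : G ≃g H) (i : ℕ) :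
    G.numDominatingSets i = H.numDominatingSets i := by
  classical
  rw [numDominatingSets_eq_card_filter, numDominatingSets_eq_card_filter]
  refine Finset.card_equiv e.toEquiv.finsetCongr fun S => ?_
  have h : ((e.toEquiv.finsetCongr S : Finset W) : Set W) = e '' (S : Set V) := by
    ext; simp
  rw [Finset.mem_filter, Finset.mem_filter, h, e.isDominatingSet_image_iff]
  simp [Finset.mem_powersetCard]

theorem Iso.dEquivalent {V W : Type*} [Fintype V] [Fintype W] {G : SimpleGraph V}
    {H : SimpleGraph W} (e : G ≃g H) : G.DEquivalent H := by
  simp only [DEquivalent, dominationPolynomial, e.numDominatingSets_eq,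
    Fintype.card_congr e.toEquiv]

theorem eq_top_iff_numDominatingSets_one {V : Type*} [Fintype V] (G : SimpleGraph V) :
    G = ⊤ ↔ G.numDominatingSets 1 = Fintype.card V := by
  classical
  have hc : Fintype.card V = (Finset.powersetCard 1 (Finset.univ : Finset V)).card := by simp
  rw [numDominatingSets_eq_card_filter, hc, Finset.card_filter_eq_iff]
  simp only [Finset.mem_powersetCard_univ, Finset.card_eq_one, forall_exists_index,
    forall_eq_apply_imp_iff, isDominatingSet_iff, Finset.coe_singleton, Set.mem_singleton_iff,
    exists_eq_left]
  rw [eq_top_iff]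
  exact ⟨fun h a u hu => h (Ne.symm hu), fun h a u hu => h a u (Ne.symm hu)⟩

/-! ### The domination polynomial as a sum of products of local weights -/

open Classical in
/-- The sum of `y ^ |T|` over the vertex sets `T` whose complement is dominating, that is, over
those `T` which contain no closed neighborhood. The set `T` is encoded by its indicator function
and the summand is written as a product over the vertices. -/
noncomputable def codominationSum {V R : Type*} [Fintype V] [CommRing R] (G : SimpleGraph V)
    (y : R) : R :=
  ∑ f : V → Bool, ∏ v, (if f v then y else 1) *
    (if ∀ u, u = v ∨ G.Adj v u → f u = true then 0 else 1)

theorem codominationSum_eq_sum {V R : Type*} [Fintype V] [CommRing R] (G : SimpleGraph V) (y : R) :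
    G.codominationSum y = ∑ i ∈ Finset.range (Fintype.card V + 1),
      (G.numDominatingSets i : R) * y ^ (Fintype.card V - i) := by
  classical
  let E : Finset V ≃ (V → Bool) :=
    { toFun := fun S v => decide (v ∉ S)
      invFun := fun f => Finset.univ.filter (f · = false)
      left_inv := fun S => by ext; simp
      right_inv := fun f => by ext v; cases h : f v <;> simp [h] }
  have hS : ∀ S : Finset V, (∏ v, (if E S v then y else 1) *
      (if ∀ u, u = v ∨ G.Adj v u → E S u = true then 0 else 1)) =
      if G.IsDominatingSet (S : Set V) then y ^ (Fintype.card V - S.card) else 0 := by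
    intro S
    rw [Finset.prod_mul_distrib]
    have h1 : (∏ v, if E S v then y else 1) = y ^ (Fintype.card V - S.card) := by
      rw [Finset.prod_ite, Finset.prod_const, Finset.prod_const_one, mul_one,
        ← Finset.card_compl]
      congr 2
      ext
      simp [E]
    rw [h1, isDominatingSet_iff]
    split_ifs with h
    · rw [Finset.prod_eq_one, mul_one]
      intro v _
      rw [if_neg]
      intro hv
      obtain ⟨w, hw, hwv⟩ := h v (by simpa [E] using hv v (Or.inl rfl))
      have := hv w (Or.inr hwv.symm)
      simp [E] at this
      exact this hw
    · push Not at h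
      obtain ⟨v, hv, hvu⟩ := h
      rw [Finset.prod_eq_zero (Finset.mem_univ v), mul_zero]
      rw [if_pos]
      rintro u (rfl | hu)
      · simpa [E] using hv
      · simp only [E, Equiv.coe_fn_mk, decide_eq_true_eq]
        exact fun huS => hvu u huS hu.symm
  rw [codominationSum, ← E.sum_comp]
  simp only [hS]
  rw [← Finset.powerset_univ, Finset.sum_powerset, Finset.card_univ]
  refine Finset.sum_congr rfl fun i _ => ?_
  rw [Finset.sum_ite, Finset.sum_const_zero, add_zero, Finset.sum_congr rfl
    (g := fun _ => y ^ (Fintype.card V - i)), Finset.sum_const, nsmul_eq_mul]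
  · rw [numDominatingSets_eq_card_filter]
  · intro S hS
    rw [(Finset.mem_powersetCard_univ.mp (Finset.mem_filter.mp hS).1)]

theorem DEquivalent.codominationSum_eq {V W R : Type*} [Fintype V] [Fintype W] [Nonempty V]
    [CommRing R] {G : SimpleGraph V} {H : SimpleGraph W} (h : G.DEquivalent H) (y : R) :
    G.codominationSum y = H.codominationSum y := by
  have : Nonempty W := Fintype.card_pos_iff.mp (h.card_eq ▸ Fintype.card_pos)
  rw [codominationSum_eq_sum, codominationSum_eq_sum, h.card_eq]
  refine Finset.sum_congr rfl fun i _ => ?_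
  rcases Nat.eq_zero_or_pos i with rfl | hi
  · rw [numDominatingSets_zero, numDominatingSets_zero]
  · rw [h.numDominatingSets_eq hi]

theorem codominationSum_eq_prod_connectedComponent {V R : Type*} [Fintype V] [CommRing R]
    (G : SimpleGraph V) [Fintype G.ConnectedComponent]
    [∀ c : G.ConnectedComponent, Fintype c] (y : R) :
    G.codominationSum y = ∏ c : G.ConnectedComponent, c.toSimpleGraph.codominationSum y := by
  classical
  let E : (Σ c : G.ConnectedComponent, c) ≃ V := Equiv.sigmaFiberEquiv G.connectedComponentMk
  simp only [codominationSum]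
  rw [Finset.prod_univ_sum]
  refine Eq.trans ?_ (Finset.sum_congr (s₁ := Finset.univ) (by ext; simp) fun _ _ => rfl)
  refine Fintype.sum_equiv ((E.arrowCongr (Equiv.refl Bool)).symm.trans
    (Equiv.piCurry fun (c : G.ConnectedComponent) (_ : c) => Bool)) _ _ fun f => ?_
  rw [← E.prod_comp, Fintype.prod_sigma]
  refine Finset.prod_congr rfl fun c _ => Finset.prod_congr rfl fun v _ => ?_
  change (if f v then y else 1) * _ = (if f v then y else 1) * _
  congr 1
  have key : (∀ u, u = (v : V) ∨ G.Adj v u → f u = true) ↔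
    ∀ u : c, u = v ∨ c.toSimpleGraph.Adj v u → f u = true := by
    constructor
    · intro h u hu
      exact h u (hu.imp (congrArg _) id)
    · intro h u hu
      have hu' : u ∈ c := by
        rcases hu with rfl | hu
        · exact v.2
        · exact c.mem_supp_of_adj_mem_supp v.2 hu
      exact h ⟨u, hu'⟩ (hu.imp Subtype.ext id)
  split_ifs with h1 h2 h2
  · rfl
  · exact absurd (key.mp h1) h2
  · exact absurd (key.mpr h2) h1
  · rfl

theorem codominationSum_cycleGraph {R : Type*} [CommRing R] (u : R) (n : ℕ) :
    (cycleGraph (n + 3)).codominationSum (u * (1 + u + u ^ 2)) = rootPowerSum u (n + 3) := by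
  rw [← cyclicWordSum_eq_rootPowerSum, cyclicWordSum_eq_sum, codominationSum]
  refine Finset.sum_congr (by ext; simp) fun f _ => ?_
  rw [← Equiv.prod_comp (Equiv.addRight (1 : Fin (n + 3)))]
  refine Finset.prod_congr rfl fun i _ => ?_
  have h12 : i + 2 = i + 1 + 1 := by rw [add_assoc]; rfl
  rw [letterWeight, Equiv.coe_addRight]
  congr 1
  have hN : ∀ w, (cycleGraph (n + 3)).Adj (i + 1) w ↔ w = i ∨ w = i + 2 := by
    intro w
    rw [← mem_neighborSet, cycleGraph_neighborSet, h12]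
    simp
  have key : (∀ w, w = i + 1 ∨ (cycleGraph (n + 3)).Adj (i + 1) w → f w = true) ↔
      (f i && f (i + 1) && f (i + 2)) = true := by
    simp only [hN, Bool.and_eq_true]
    constructor
    · intro h
      exact ⟨⟨h i (by simp), h (i + 1) (by simp)⟩, h (i + 2) (by simp)⟩
    · rintro ⟨⟨h0, h1⟩, h2⟩ w (rfl | rfl | rfl) <;> assumption
  split_ifs with h1 h2 h2
  · rfl
  · exact absurd (key.mp h1) h2
  · exact absurd (key.mpr h2) h1
  · rfl

/-! ### Recognising a cycle -/

/-- A connected finite graph all of whose vertices have degree two is a cycle. -/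
theorem Connected.nonempty_iso_cycleGraph {V : Type*} [Fintype V] {G : SimpleGraph V}
    (hG : G.Connected) (h2 : ∀ v, (G.neighborSet v).ncard = 2) :
    3 ≤ Fintype.card V ∧ Nonempty (G ≃g cycleGraph (Fintype.card V)) := by
  classical
  obtain ⟨v⟩ := hG.nonempty
  have hc : G.IsCycles := fun v _ => h2 v
  obtain ⟨p, hp, hsupp⟩ := hc.exists_cycle_toSubgraph_verts_eq_connectedComponentSupp
    (v := v) (c := G.connectedComponentMk v) rfl
    (Set.nonempty_of_ncard_ne_zero (by rw [h2]; norm_num))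
  have hmem : ∀ w, w ∈ p.support := by
    intro w
    rw [← Walk.mem_verts_toSubgraph, hsupp]
    exact ConnectedComponent.sound (hG.preconnected w v)
  have hham : p.IsHamiltonianCycle := by
    refine ⟨hp, hp.isPath_tail.isHamiltonian_of_mem fun w => ?_⟩
    rw [Walk.support_tail_of_not_nil _ hp.not_nil]
    rcases List.mem_cons.mp (p.cons_tail_support ▸ hmem w) with rfl | hw
    · exact Walk.end_mem_tail_support hp.not_nil
    · exact hw
  have hlen := hham.length_eq
  have h3 : 3 ≤ Fintype.card V := hlen ▸ hp.three_le_length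
  refine ⟨h3, ?_⟩
  obtain ⟨f⟩ := (cycleGraph_isContained_iff (by omega)).mpr ⟨v, p, hp, hlen⟩
  have hbij : Function.Bijective f :=
    (Fintype.bijective_iff_injective_and_card f).mpr ⟨f.injective, by simp⟩
  refine ⟨RelIso.symm ⟨Equiv.ofBijective f hbij, fun {a b} => ?_⟩⟩
  refine ⟨fun hab => ?_, fun hab => f.toHom.map_adj hab⟩
  -- Both neighborhoods have two elements, so `f` maps one onto the other.
  have himg : f '' (cycleGraph (Fintype.card V)).neighborSet a = G.neighborSet (f a) := by
    refine Set.eq_of_subset_of_ncard_le ?_ ?_ (Set.toFinite _)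
    · rintro _ ⟨w, hw, rfl⟩
      exact f.toHom.map_adj hw
    · rw [Set.ncard_image_of_injective _ hbij.injective, h2]
      obtain ⟨k, hk⟩ := Nat.exists_eq_add_of_le' h3
      have hdeg : ∀ {N : ℕ} (_ : N = k + 3) (a : Fin N),
          2 ≤ ((cycleGraph N).neighborSet a).ncard := by
        rintro _ rfl a
        rw [← cycleGraph_degree_three_le (v := a), ← card_neighborSet_eq_degree,
          Set.ncard_eq_toFinset_card', Set.toFinset_card]
      exact hdeg hk a
  have hb : f b ∈ G.neighborSet (f a) := hab
  rw [← himg, hbij.injective.mem_set_image] at hb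
  exact hb

/-! ### Regularity from the large dominating sets -/

open Classical in
/-- The closed neighborhood as a finset. -/
noncomputable def closedNeighborFinset {V : Type*} [Fintype V] (G : SimpleGraph V) (v : V) :
    Finset V :=
  {u | u = v ∨ G.Adj v u}

theorem mem_closedNeighborFinset {V : Type*} [Fintype V] {G : SimpleGraph V} {v u : V} :
    u ∈ G.closedNeighborFinset v ↔ u = v ∨ G.Adj v u := by
  simp [closedNeighborFinset]

theorem ncard_neighborSet_add_one {V : Type*} [Fintype V] (G : SimpleGraph V) (v : V) :
    (G.neighborSet v).ncard + 1 = (G.closedNeighborFinset v).card := by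
  have h : (G.closedNeighborFinset v : Set V) = insert v (G.neighborSet v) := by
    ext u
    simp [mem_closedNeighborFinset]
  rw [← Set.ncard_coe_finset, h, Set.ncard_insert_of_notMem (by simp)]

open Classical in
theorem numDominatingSets_add_card {V : Type*} [Fintype V] (G : SimpleGraph V) {k : ℕ}
    (hk : k ≤ Fintype.card V) :
    G.numDominatingSets (Fintype.card V - k) +
      ((Finset.univ.powersetCard k).filter fun T => ∃ v, G.closedNeighborFinset v ⊆ T).card =
      (Fintype.card V).choose k := by
  have h1 : G.numDominatingSets (Fintype.card V - k) =
      ((Finset.univ.powersetCard k).filter fun T => ¬ ∃ v, G.closedNeighborFinset v ⊆ T).card := by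
    rw [numDominatingSets_eq_card_filter]
    refine Finset.card_equiv (Equiv.mk compl compl compl_compl compl_compl) fun S => ?_
    simp only [Equiv.coe_fn_mk, Finset.mem_filter, Finset.mem_powersetCard_univ,
      Finset.card_compl, isDominatingSet_iff]
    refine and_congr ?_ ?_
    · have := Finset.card_le_univ S
      omega
    · push Not
      refine forall_congr' fun u => ?_
      simp only [Finset.not_subset, mem_closedNeighborFinset, Finset.mem_compl, not_not,
        Finset.mem_coe]
      constructor
      · intro h
        by_cases hu : u ∈ S
        · exact ⟨u, Or.inl rfl, hu⟩
        · obtain ⟨v, hv, hvu⟩ := h hu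
          exact ⟨v, Or.inr hvu.symm, hv⟩
      · rintro ⟨v, rfl | hv, hvS⟩ hu
        · exact absurd hvS hu
        · exact ⟨v, hvS, hv.symm⟩
  rw [h1, add_comm, Finset.card_filter_add_card_filter_not, Finset.card_powersetCard,
    Finset.card_univ]

theorem numDominatingSets_card_sub_two_eq_iff {V : Type*} [Fintype V] (G : SimpleGraph V)
    (hV : 2 ≤ Fintype.card V) :
    G.numDominatingSets (Fintype.card V - 2) = (Fintype.card V).choose 2 ↔
      ∀ v, 3 ≤ (G.closedNeighborFinset v).card := by
  classical
  have h := G.numDominatingSets_add_card hV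
  have h0 : G.numDominatingSets (Fintype.card V - 2) = (Fintype.card V).choose 2 ↔
      ((Finset.univ.powersetCard 2).filter
        fun T => ∃ v, G.closedNeighborFinset v ⊆ T).card = 0 := by omega
  rw [h0, Finset.card_eq_zero, Finset.filter_eq_empty_iff]
  simp only [Finset.mem_powersetCard_univ]
  constructor
  · intro hT v
    by_contra hlt
    obtain ⟨T, hvT, hT2⟩ := Finset.exists_superset_card_eq (s := G.closedNeighborFinset v)
      (n := 2) (by omega) hV
    exact hT hT2 ⟨v, hvT⟩
  · rintro hv T hT ⟨v, hvT⟩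
    have := Finset.card_le_card hvT
    have := hv v
    omega

/-- In a graph of minimum degree at least two, a vertex set of size three contains a closed
neighborhood only if it is the closed neighborhood of a vertex of degree two. -/
theorem numDominatingSets_card_sub_three_add {V : Type*} [Fintype V] [DecidableEq V]
    (G : SimpleGraph V)
    (hV : 3 ≤ Fintype.card V) (h3 : ∀ v, 3 ≤ (G.closedNeighborFinset v).card) :
    G.numDominatingSets (Fintype.card V - 3) +
      ((Finset.univ.filter fun v => (G.closedNeighborFinset v).card = 3).image
        G.closedNeighborFinset).card = (Fintype.card V).choose 3 := by
  rw [← G.numDominatingSets_add_card hV]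
  congr 2
  ext T
  simp only [Finset.mem_image, Finset.mem_filter, Finset.mem_univ, true_and,
    Finset.mem_powersetCard_univ]
  constructor
  · rintro ⟨v, hv, rfl⟩
    exact ⟨hv, v, subset_rfl⟩
  · rintro ⟨hT, v, hv⟩
    have := Finset.eq_of_subset_of_card_le hv (by rw [hT]; exact h3 v)
    exact ⟨v, by rw [this, hT], this⟩

theorem closedNeighborFinset_cycleGraph (n : ℕ) (i : Fin (n + 4)) :
    (cycleGraph (n + 4)).closedNeighborFinset i = {i, i - 1, i + 1} := by
  ext w
  rw [mem_closedNeighborFinset, ← mem_neighborSet, cycleGraph_neighborSet]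
  simp

theorem card_closedNeighborFinset_cycleGraph (n : ℕ) (i : Fin (n + 4)) :
    ((cycleGraph (n + 4)).closedNeighborFinset i).card = 3 := by
  rw [← ncard_neighborSet_add_one, Set.ncard_eq_toFinset_card', Set.toFinset_card,
    card_neighborSet_eq_degree, cycleGraph_degree_three_le (n := n + 1)]

theorem closedNeighborFinset_cycleGraph_injective (n : ℕ) :
    Function.Injective (cycleGraph (n + 4)).closedNeighborFinset := by
  intro i j hij
  have e : ∀ w : Fin (n + 4), w ∈ ({i, i - 1, i + 1} : Finset _) ↔
      w ∈ ({j, j - 1, j + 1} : Finset _) := by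
    rw [← closedNeighborFinset_cycleGraph, ← closedNeighborFinset_cycleGraph, hij]
    exact fun _ => Iff.rfl
  -- If `j = i + 1` then `j + 1` is missing on the left; if `j = i - 1` then `j - 1` is.
  have n1 : (1 : Fin (n + 4)) ≠ 0 := by simp
  have n2 : (1 : Fin (n + 4)) + 1 ≠ 0 := by
    simp [Fin.ext_iff, Fin.val_add, Nat.mod_eq_of_lt]
  have n3 : (1 : Fin (n + 4)) + (1 + 1) ≠ 0 := by
    simp [Fin.ext_iff, Fin.val_add, Nat.mod_eq_of_lt]
  have hj := (e j).mpr (by simp)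
  simp only [Finset.mem_insert, Finset.mem_singleton] at hj
  rcases hj with hj | hj | hj
  · exact hj.symm
  · have := (e (j - 1)).mpr (by simp)
    simp only [Finset.mem_insert, Finset.mem_singleton, hj] at this
    exfalso
    rcases this with h | h | h
    · rw [sub_sub, sub_eq_self] at h
      exact n2 h
    · rw [sub_eq_self] at h
      exact n1 h
    · rw [sub_sub, sub_eq_iff_eq_add, add_assoc, left_eq_add] at h
      exact n3 h
  · have := (e (j + 1)).mpr (by simp)
    simp only [Finset.mem_insert, Finset.mem_singleton, hj] at this
    exfalso
    rcases this with h | h | h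
    · rw [add_assoc, add_eq_left] at h
      exact n2 h
    · rw [eq_sub_iff_add_eq, add_assoc, add_assoc, add_eq_left] at h
      exact n3 h
    · rw [add_eq_left] at h
      exact n1 h

theorem DEquivalent.ncard_neighborSet_eq_two {W : Type*} [Fintype W] {H : SimpleGraph W} {n : ℕ}
    (h : H.DEquivalent (cycleGraph (n + 4))) (w : W) : (H.neighborSet w).ncard = 2 := by
  classical
  have hcard : Fintype.card W = n + 4 := by rw [h.card_eq, Fintype.card_fin]
  have hC := fun i => (card_closedNeighborFinset_cycleGraph n i).ge
  have hH : ∀ v, 3 ≤ (H.closedNeighborFinset v).card := by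
    rw [← numDominatingSets_card_sub_two_eq_iff _ (by omega),
      h.numDominatingSets_eq (by omega), h.card_eq,
      numDominatingSets_card_sub_two_eq_iff _ (by simp)]
    exact hC
  have h1 := H.numDominatingSets_card_sub_three_add (by omega) hH
  have h2 := (cycleGraph (n + 4)).numDominatingSets_card_sub_three_add (by simp) hC
  rw [h.numDominatingSets_eq (by omega), h.card_eq, ← h2, add_right_inj,
    Finset.filter_true_of_mem fun i _ => card_closedNeighborFinset_cycleGraph n i,
    Finset.card_image_of_injective _ (closedNeighborFinset_cycleGraph_injective n),
    Finset.card_univ, Fintype.card_fin, ← hcard, ← Finset.card_univ] at h1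
  have h3 := (Finset.card_filter_eq_iff.mp
    (le_antisymm (Finset.card_filter_le _ _) (h1.ge.trans Finset.card_image_le)))
    w (Finset.mem_univ w)
  have := H.ncard_neighborSet_add_one w
  omega

/-! ### Cycles are determined by their domination polynomials -/

theorem nonempty_iso_cycleGraph_of_dEquivalent {W : Type*} [Fintype W] {H : SimpleGraph W} {n : ℕ}
    (h : H.DEquivalent (cycleGraph (n + 4))) : Nonempty (H ≃g cycleGraph (n + 4)) := by
  classical
  have hcard : Fintype.card W = n + 4 := by rw [h.card_eq, Fintype.card_fin]
  have hW : Nonempty W := Fintype.card_pos_iff.mp (by omega)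
  have hcomp : ∀ c : H.ConnectedComponent, 3 ≤ Fintype.card c ∧
      Nonempty (c.toSimpleGraph ≃g cycleGraph (Fintype.card c)) := by
    intro c
    refine c.connected_toSimpleGraph.nonempty_iso_cycleGraph fun v => ?_
    rw [← h.ncard_neighborSet_eq_two v.1,
      ← Set.ncard_image_of_injective _ (Subtype.val_injective (p := (· ∈ c)))]
    congr 1
    ext w
    constructor
    · rintro ⟨w, hw, rfl⟩
      exact hw
    · exact fun hw => ⟨⟨w, c.mem_supp_of_adj_mem_supp v.2 hw⟩, hw, rfl⟩
  have hsum : ∑ c : H.ConnectedComponent, Fintype.card c = n + 4 := by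
    rw [← hcard, ← Fintype.card_sigma]
    exact Fintype.card_congr (Equiv.sigmaFiberEquiv H.connectedComponentMk)
  have hsub : Subsingleton H.ConnectedComponent := by
    refine subsingleton_of_prod_rootPowerSum_eq (fun c => Fintype.card c)
      (fun c => by have := (hcomp c).1; omega) ?_
    rw [hsum, ← codominationSum_cycleGraph _ (n + 1), ← h.codominationSum_eq,
      codominationSum_eq_prod_connectedComponent]
    refine Finset.prod_congr rfl fun c _ => ?_
    obtain ⟨h3, ⟨e⟩⟩ := hcomp c
    have : Nonempty c := c.connected_toSimpleGraph.nonempty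
    rw [e.dEquivalent.codominationSum_eq]
    obtain ⟨k, hk⟩ := Nat.exists_eq_add_of_le' h3
    rw [hk, codominationSum_cycleGraph]
  have hconn : H.Connected :=
    ⟨fun a b => ConnectedComponent.exact (Subsingleton.elim _ _)⟩
  exact hcard ▸ (hconn.nonempty_iso_cycleGraph h.ncard_neighborSet_eq_two).2

end SimpleGraph

theorem theorem1 (n : ℕ) (hn : 1 ≤ n) :
    SimpleGraph.IsDUnique.{0, v} (SimpleGraph.cycleGraph n) := by
  intro W _ H
  refine ⟨fun h => ?_, fun ⟨e⟩ => e.dEquivalent⟩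
  rcases Nat.lt_or_ge n 4 with hlt | hge
  · have htop : SimpleGraph.cycleGraph n = ⊤ := by
      interval_cases n
      · exact SimpleGraph.cycleGraph_one_eq_top
      · exact SimpleGraph.cycleGraph_two_eq_top
      · exact SimpleGraph.cycleGraph_three_eq_top
    have hH : H = ⊤ := by
      rw [SimpleGraph.eq_top_iff_numDominatingSets_one, h.numDominatingSets_eq le_rfl, h.card_eq]
      exact (SimpleGraph.eq_top_iff_numDominatingSets_one _).mp htop
    rw [hH, htop]
    exact ⟨SimpleGraph.Iso.completeGraph (Fintype.equivOfCardEq h.card_eq)⟩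
  · obtain ⟨k, rfl⟩ := Nat.exists_eq_add_of_le' hge
    exact SimpleGraph.nonempty_iso_cycleGraph_of_dEquivalent h
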